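/- Let $n\ge 1$, $L\ge 0$, let $U$ be a unitary on $n$ qubits with $\mathcal U(\cdot)=U\cdot U^\dagger$, let $\mathcal N=\sum_i E_i\cdot E_i^\dagger$ be a unital noise channel on $n$ qubits ($\sum_i E_i^\dagger E_i=I$ and $\mathcal N(I)=I$), and let $\rho_0$ be an $n$-qubit state. Fix a pure $n$-qubit state $|\psi\rangle$ and define the unitarity $u$ and the average noise strength $s$ of $\mathcal N$ by $$u=\frac{2^n}{2^n-1}\Big(\mathbb E_{V}\big[\mathrm{tr}[\mathcal N(V|\psi\rangle\langle\psi|V^\dagger)^2]\big]-\frac1{2^n}\Big),\qquad s=\frac{2^n}{2^n-1}\Big(\mathbb E_{V}\big[\mathrm{tr}[V|\psi\rangle\langle\psi|V^\dagger\,\mathcal N(V|\psi\rangle\langle\psi|V^\dagger)]\big]-\frac1{2^n}\Big),$$ where $V$ is drawn from the Haar probability measure on the unitary group $\mathrm U(2^n)$. Assume $u\ne 0$. Let $C_1,\dots,C_{L+1}$ be drawn independently and uniformly from the $n$-qubit Clifford group (the normalizer of the Pauli group in $\mathrm U(2^n)$, modulo global phases, which is a finite group), write $\mathcal C_l(\cdot)=C_l\cdot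 C_l^\dagger$, and set $$\rho_{\mathrm{ideal}}=\mathcal C_{L+1}\circ\mathcal U\circ\mathcal C_L\circ\cdots\circ\mathcal U\circ\mathcal C_1(\rho_0),\qquad \rho_{\mathrm{noisy}}=\mathcal C_{L+1}\circ\mathcal N\circ\mathcal U\circ\mathcal C_L\circ\cdots\circ\mathcal N\circ\mathcal U\circ\mathcal C_1(\rho_0).$$ Then, for every traceless Hermitian $O$ with operator norm $\|O\|\le 1$, and with $R=(s/u)^L$, $$\mathbb E_{C}\Big[\big|R\,\mathrm{tr}[\rho_{\mathrm{noisy}}O]-\mathrm{tr}[\rho_{\mathrm{ideal}}O]\big|\Big]\le\sqrt{\frac{2^n-1}{2^n+1}\Big(1-\Big(\frac{s^2}{u}\Big)^L\Big)},$$ where $\mathbb E_C$ is the uniform average over all $C_1,\dots,C_{L+1}$. -/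

import Mathlib

open scoped BigOperators Matrix ComplexOrder

noncomputable section

/-! ### Qubits and operators -/

/-- Labels of the computational basis of `n` qubits. -/
abbrev Bits (n : ℕ) : Type := Fin n → Fin 2

/-- Operators on the Hilbert space of `n` qubits, as matrices in the computational basis. -/
abbrev Op (n : ℕ) : Type := Matrix (Bits n) (Bits n) ℂ

/-- The unitary group `U(2 ^ n)`. -/
abbrev UGroup (n : ℕ) : Type := Matrix.unitaryGroup (Bits n) ℂ

/-! ### The Pauli group -/

/-- The one-qubit Pauli matrices `I, X, Y, Z`. -/
def pauli : Fin 4 → Matrix (Fin 2) (Fin 2) ℂ :=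
  ![1, !![0, 1; 1, 0], !![0, -Complex.I; Complex.I, 0], !![1, 0; 0, -1]]

/-- The Pauli operator `P_{a 0} ⊗ ... ⊗ P_{a (n - 1)}`. -/
def pauliString {n : ℕ} (a : Fin n → Fin 4) : Op n :=
  Matrix.of fun x y => ∏ i, pauli (a i) (x i) (y i)

theorem pauli_mul (a b : Fin 4) :
    ∃ (k : ℕ) (c : Fin 4), pauli a * pauli b = Complex.I ^ k • pauli c := by
  have h3 : Complex.I ^ 3 = -Complex.I := Complex.I_pow_three
  fin_cases a <;> fin_cases b
  · exact ⟨0, 0, by simp [pauli]⟩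
  · exact ⟨0, 1, by simp [pauli]⟩
  · exact ⟨0, 2, by simp [pauli]⟩
  · exact ⟨0, 3, by simp [pauli]⟩
  · exact ⟨0, 1, by simp [pauli]⟩
  · exact ⟨0, 0, by simp [pauli, Matrix.one_fin_two]⟩
  · exact ⟨1, 3, by simp [pauli]⟩
  · exact ⟨3, 2, by simp [pauli, h3]⟩
  · exact ⟨0, 2, by simp [pauli]⟩
  · exact ⟨3, 3, by simp [pauli, h3]⟩
  · exact ⟨0, 0, by simp [pauli, Matrix.one_fin_two]⟩
  · exact ⟨1, 1, by simp [pauli]⟩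
  · exact ⟨0, 3, by simp [pauli]⟩
  · exact ⟨1, 2, by simp [pauli]⟩
  · exact ⟨3, 1, by simp [pauli, h3]⟩
  · exact ⟨0, 0, by simp [pauli, Matrix.one_fin_two]⟩

theorem pauli_sq (a : Fin 4) : pauli a * pauli a = 1 := by
  fin_cases a <;> simp [pauli, Matrix.one_fin_two]

theorem pauli_star (a : Fin 4) (x y : Fin 2) : star (pauli a x y) = pauli a y x := by
  fin_cases a <;> fin_cases x <;> fin_cases y <;> simp [pauli]

theorem pauliString_mul_apply {n : ℕ} (a b : Fin n → Fin 4) (x y : Bits n) :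
    (pauliString a * pauliString b) x y = ∏ i, (pauli (a i) * pauli (b i)) (x i) (y i) := by
  simp only [Matrix.mul_apply, pauliString, Matrix.of_apply, ← Finset.prod_mul_distrib]
  rw [Finset.prod_univ_sum, Fintype.piFinset_univ]

theorem pauliString_star {n : ℕ} (a : Fin n → Fin 4) :
    star (pauliString a) = pauliString a := by
  ext x y
  simp only [Matrix.star_apply, pauliString, Matrix.of_apply, star_prod, pauli_star]

theorem pauliString_sq {n : ℕ} (a : Fin n → Fin 4) : pauliString a * pauliString a = 1 := by
  ext x y
  rw [pauliString_mul_apply]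
  simp only [pauli_sq, Matrix.one_apply]
  by_cases h : x = y
  · simp [h]
  · obtain ⟨i, hi⟩ := Function.ne_iff.mp h
    rw [if_neg h]
    exact Finset.prod_eq_zero (Finset.mem_univ i) (if_neg hi)

theorem pauliString_mul {n : ℕ} (a b : Fin n → Fin 4) :
    ∃ (k : ℕ) (c : Fin n → Fin 4),
      pauliString a * pauliString b = Complex.I ^ k • pauliString c := by
  choose k c h using fun i => pauli_mul (a i) (b i)
  refine ⟨∑ i, k i, c, ?_⟩
  ext x y
  rw [pauliString_mul_apply]
  simp [h, pauliString, Finset.prod_mul_distrib, Finset.prod_pow_eq_pow_sum]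

theorem pauliString_one {n : ℕ} : (1 : Op n) = pauliString fun _ => 0 := by
  ext x y
  simp only [pauliString, Matrix.of_apply, pauli, Matrix.one_apply, Matrix.cons_val_zero]
  by_cases h : x = y
  · simp [h]
  · obtain ⟨i, hi⟩ := Function.ne_iff.mp h
    rw [if_neg h]
    exact (Finset.prod_eq_zero (Finset.mem_univ i) (if_neg hi)).symm

/-- The `n`-qubit Pauli group `{i ^ k P : P ∈ {I, X, Y, Z} ^ ⊗ n}`. -/
def pauliGroup (n : ℕ) : Subgroup (UGroup n) where
  carrier := {P | ∃ (k : ℕ) (a : Fin n → Fin 4), (P : Op n) = Complex.I ^ k • pauliString a}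
  one_mem' := ⟨0, fun _ => 0, by simp [pauliString_one]⟩
  mul_mem' := by
    rintro P Q ⟨k, a, hP⟩ ⟨l, b, hQ⟩
    obtain ⟨m, c, h⟩ := pauliString_mul a b
    refine ⟨k + l + m, c, ?_⟩
    rw [Submonoid.coe_mul, hP, hQ, smul_mul_smul_comm, h, smul_smul, pow_add, pow_add]
  inv_mem' := by
    rintro P ⟨k, a, hP⟩
    refine ⟨3 * k, a, ?_⟩
    rw [← Unitary.star_eq_inv, Unitary.coe_star, hP, star_smul, pauliString_star, pow_mul,
      Complex.I_pow_three, star_pow]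
    simp

/-! ### The Clifford group -/

/-- The `n`-qubit Clifford group: the unitaries that normalize the Pauli group. It contains all
global phases. -/
def cliffordGroup (n : ℕ) : Subgroup (UGroup n) :=
  Subgroup.normalizer (pauliGroup n : Set (UGroup n))

/-- The channels `ρ ↦ C ρ C†` with `C` in the Clifford group. As `C` and `C'` give the same channel
exactly if they differ by a global phase, this is the Clifford group modulo global phases, a finite
group. -/
def cliffordLayers (n : ℕ) : Subgroup (Op n ≃⋆ₐ[ℂ] Op n) :=
  (cliffordGroup n).map (Unitary.conjStarAlgAut ℂ (Op n))

theorem single_eq_sum_pauli (x y : Fin 2) : ∃ c : Fin 4 → ℂ, ∀ x' y' : Fin 2,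
    Matrix.single x y (1 : ℂ) x' y' = ∑ a, c a * pauli a x' y' := by
  fin_cases x <;> fin_cases y
  · refine ⟨![1 / 2, 0, 0, 1 / 2], fun x' y' => ?_⟩
    fin_cases x' <;> fin_cases y' <;> simp [pauli, Fin.sum_univ_four]; norm_num
  · refine ⟨![0, 1 / 2, Complex.I / 2, 0], fun x' y' => ?_⟩
    fin_cases x' <;> fin_cases y' <;> simp [pauli, Fin.sum_univ_four] <;> ring_nf <;>
      simp <;> norm_num
  · refine ⟨![0, 1 / 2, -Complex.I / 2, 0], fun x' y' => ?_⟩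
    fin_cases x' <;> fin_cases y' <;> simp [pauli, Fin.sum_univ_four] <;> ring_nf <;>
      simp <;> norm_num
  · refine ⟨![1 / 2, 0, 0, -1 / 2], fun x' y' => ?_⟩
    fin_cases x' <;> fin_cases y' <;> simp [pauli, Fin.sum_univ_four] <;> norm_num

theorem span_pauliString (n : ℕ) :
    Submodule.span ℂ (Set.range (pauliString : (Fin n → Fin 4) → Op n)) = ⊤ := by
  rw [eq_top_iff]
  intro A _
  rw [Matrix.matrix_eq_sum_single A]
  refine Submodule.sum_mem _ fun x _ => Submodule.sum_mem _ fun y _ => ?_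
  have key : Matrix.single x y (A x y) = A x y • Matrix.single x y (1 : ℂ) := by
    rw [Matrix.smul_single, smul_eq_mul, mul_one]
  rw [key]
  refine Submodule.smul_mem _ _ ?_
  choose c hc using fun i => single_eq_sum_pauli (x i) (y i)
  have : (Matrix.single x y (1 : ℂ) : Op n)
      = ∑ a : Fin n → Fin 4, (∏ i, c i (a i)) • pauliString a := by
    ext x' y'
    have h1 : (Matrix.single x y (1 : ℂ) : Op n) x' y'
        = ∏ i, Matrix.single (x i) (y i) (1 : ℂ) (x' i) (y' i) := by
      by_cases h : x = x' ∧ y = y'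
      · obtain ⟨rfl, rfl⟩ := h
        simp
      · rw [Matrix.single_apply, if_neg h]
        have : ∃ i, ¬ (x i = x' i ∧ y i = y' i) := by
          by_contra hcon
          push Not at hcon
          exact h ⟨funext fun i => (hcon i).1, funext fun i => (hcon i).2⟩
        obtain ⟨i, hi⟩ := this
        refine (Finset.prod_eq_zero (Finset.mem_univ i) ?_).symm
        rw [Matrix.single_apply, if_neg hi]
    rw [h1]
    simp only [hc]
    rw [Finset.prod_univ_sum, Fintype.piFinset_univ, Matrix.sum_apply]
    simp [pauliString, Finset.prod_mul_distrib]
  rw [this]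
  exact Submodule.sum_mem _ fun a _ => Submodule.smul_mem _ _ (Submodule.subset_span ⟨a, rfl⟩)

instance finite_cliffordLayers (n : ℕ) : Finite (cliffordLayers n) := by
  have hval : ∀ (f : cliffordLayers n) (a : Fin n → Fin 4), ∃ p : Fin 4 × (Fin n → Fin 4),
      (f : Op n ≃⋆ₐ[ℂ] Op n) (pauliString a) = Complex.I ^ (p.1 : ℕ) • pauliString p.2 := by
    rintro ⟨f, C, hC, rfl⟩ a
    have hu : pauliString a ∈ Matrix.unitaryGroup (Bits n) ℂ := by
      rw [Matrix.mem_unitaryGroup_iff, pauliString_star, pauliString_sq]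
    have hP : (⟨pauliString a, hu⟩ : UGroup n) ∈ pauliGroup n := ⟨0, a, by simp⟩
    obtain ⟨k, b, h⟩ := ((Subgroup.mem_set_normalizer_iff.mp hC) _).mp hP
    refine ⟨(⟨k % 4, Nat.mod_lt _ (by norm_num)⟩, b), ?_⟩
    rw [← Complex.I_pow_eq_pow_mod, ← h]
    rfl
  choose F hF using hval
  refine Finite.of_injective F fun f g hfg => ?_
  apply Subtype.ext
  have hlin : ((f : Op n ≃⋆ₐ[ℂ] Op n) : Op n →ₗ[ℂ] Op n)
      = ((g : Op n ≃⋆ₐ[ℂ] Op n) : Op n →ₗ[ℂ] Op n) := by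
    refine LinearMap.ext_on_range (span_pauliString n) fun a => ?_
    change (f : Op n ≃⋆ₐ[ℂ] Op n) (pauliString a) = (g : Op n ≃⋆ₐ[ℂ] Op n) (pauliString a)
    rw [hF, hF, hfg]
  exact StarAlgEquiv.ext fun X => LinearMap.congr_fun hlin X

instance fintypeCliffordLayers (n : ℕ) : Fintype (cliffordLayers n) := Fintype.ofFinite _

/-! ### The Haar measure on the unitary group -/

instance compactSpace_UGroup (n : ℕ) : CompactSpace (UGroup n) := by
  refine isCompact_iff_compactSpace.mp (IsCompact.of_isClosed_subset (s := {A : Op n |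
    ∀ x ∈ Set.univ, A x ∈ {v : Bits n → ℂ | ∀ y ∈ Set.univ, v y ∈ Metric.closedBall (0 : ℂ) 1}})
    ?_ isClosed_unitary ?_)
  · exact isCompact_univ_pi fun x => isCompact_univ_pi fun y => isCompact_closedBall 0 1
  · intro A hA x _ y _
    simpa using entry_norm_bound_of_unitary hA x y

instance measurableSpace_UGroup (n : ℕ) : MeasurableSpace (UGroup n) := borel _

instance borelSpace_UGroup (n : ℕ) : BorelSpace (UGroup n) := ⟨rfl⟩

/-- The Haar probability measure on `U(2 ^ n)`. -/
def haarU (n : ℕ) : MeasureTheory.Measure (UGroup n) := MeasureTheory.Measure.haarMeasure ⊤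

/-! ### States, noise channels, unitarity and average noise strength -/

/-- Density matrices. -/
def IsDensity {n : ℕ} (ρ : Op n) : Prop := ρ.PosSemidef ∧ ρ.trace = 1

/-- Quantum channels: completely positive trace preserving maps, in Kraus form. -/
def IsChannel {n : ℕ} (N : Op n →ₗ[ℂ] Op n) : Prop :=
  ∃ (r : ℕ) (E : Fin r → Op n), (∑ i, (E i)ᴴ * E i = 1) ∧ ∀ X, N X = ∑ i, E i * X * (E i)ᴴ

/-- The channel `X ↦ V X V†` of a unitary `V`. -/
def unitaryChannel {n : ℕ} (V : UGroup n) (X : Op n) : Op n := (V : Op n) * X * (V : Op n)ᴴ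

/-- The projector `|ψ⟩⟨ψ|`. -/
def proj {n : ℕ} (ψ : Bits n → ℂ) : Op n := Matrix.vecMulVec ψ (star ψ)

/-- The unitarity `u` of `N`, with the reference state `ψ`:
`2^n / (2^n - 1) * (E_V tr[N(V|ψ⟩⟨ψ|V†)²] - 1 / 2^n)` with `V` Haar random. -/
def unitarity {n : ℕ} (ψ : Bits n → ℂ) (N : Op n →ₗ[ℂ] Op n) : ℝ :=
  2 ^ n / (2 ^ n - 1) *
    ((∫ V, (N (unitaryChannel V (proj ψ)) ^ 2).trace.re ∂(haarU n)) - 1 / 2 ^ n)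

/-- The average noise strength `s` of `N`, with the reference state `ψ`:
`2^n / (2^n - 1) * (E_V tr[V|ψ⟩⟨ψ|V† N(V|ψ⟩⟨ψ|V†)] - 1 / 2^n)` with `V` Haar random. -/
def noiseStrength {n : ℕ} (ψ : Bits n → ℂ) (N : Op n →ₗ[ℂ] Op n) : ℝ :=
  2 ^ n / (2 ^ n - 1) *
    ((∫ V, (unitaryChannel V (proj ψ) * N (unitaryChannel V (proj ψ))).trace.re ∂(haarU n))
      - 1 / 2 ^ n)

/-! ### The random circuit -/

/-- The output `C_{L+1} ∘ Λ ∘ C_L ∘ ... ∘ Λ ∘ C_1 (ρ₀)` of a circuit in which the map `Λ` is applied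
between consecutive Clifford layers; the layers are numbered from `0` to `L` here. -/
def circuitOutput {n : ℕ} (Λ : Op n → Op n) (ρ₀ : Op n) :
    (L : ℕ) → (Fin (L + 1) → cliffordLayers n) → Op n
  | 0, C => (C 0 : Op n ≃⋆ₐ[ℂ] Op n) ρ₀
  | L + 1, C => (C (Fin.last (L + 1)) : Op n ≃⋆ₐ[ℂ] Op n)
      (Λ (circuitOutput Λ ρ₀ L fun l => C l.castSucc))

/-- The noiseless output state, with the non-Clifford layer `U`. -/
def idealState {n : ℕ} (U : UGroup n) (ρ₀ : Op n) (L : ℕ) (C : Fin (L + 1) → cliffordLayers n) :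
    Op n :=
  circuitOutput (unitaryChannel U) ρ₀ L C

/-- The noisy output state: the noise `N` follows each non-Clifford layer `U`. -/
def noisyState {n : ℕ} (U : UGroup n) (N : Op n →ₗ[ℂ] Op n) (ρ₀ : Op n) (L : ℕ)
    (C : Fin (L + 1) → cliffordLayers n) : Op n :=
  circuitOutput (fun X => N (unitaryChannel U X)) ρ₀ L C

end

/-! By Cauchy-Schwarz it suffices to bound the second moment of the error. Expanding the square
leaves three averages of products `tr[X O] tr[Y O]`, with `X` and `Y` outputs of circuits that share
the same Clifford layers.

The engine is `twirl_eq`: averaging any bilinear form over Cliffords acting simultaneously on both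
arguments gives a multiple, `twirlCoeff`, of the trace form `tr[X Y]`, provided `X` is traceless.
Conjugation by Pauli strings kills the terms with distinct strings, and Cliffords act transitively
on non-identity strings, so all remaining diagonal terms agree. Applied layer by layer
(`expect_circuitOutput`), this yields one factor from the observable, one factor `twirlCoeff
(traceForm Λ₁ Λ₂)` for each of the `L` noise layers, and the squared Hilbert-Schmidt norm of the
traceless part of the initial state.

The Haar averages defining `u` and `s` are governed by the same coefficients, since Haar measure
absorbs Cliffords (`integral_bilinear_unitaryMap`); the layer factors are therefore `u`, `s` and
`1`, and `U` drops out. Up to a nonnegative constant the second moment is `R² u^L - 2 R s^L + 1`,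
which equals `1 - (s²/u)^L` for the given `R`. The constant is bounded using `tr[O²] ≤ 2^n` and the
purity bound `tr[ρ₀²] ≤ 1`. -/

/-! ### Commutation of Pauli strings -/

/-- The sign in `P Q = ± Q P` for one-qubit Pauli matrices. -/
def pauliSign (x y : Fin 4) : ℤ := if x = 0 ∨ y = 0 ∨ x = y then 1 else -1

theorem pauli_mul_comm (x y : Fin 4) :
    pauli x * pauli y = (pauliSign x y : ℂ) • (pauli y * pauli x) := by
  fin_cases x <;> fin_cases y <;> simp [pauli, pauliSign]

theorem exists_pauliSign_ne {x y : Fin 4} (h : x ≠ y) :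
    ∃ z, pauliSign z x ≠ pauliSign z y := by
  revert x y
  decide

theorem pauliSign_eq (x y : Fin 4) : pauliSign x y = 1 ∨ pauliSign x y = -1 := by
  unfold pauliSign; split_ifs <;> simp

/-- The sign in `P Q = ± Q P` for Pauli strings. -/
def stringSign {n : ℕ} (a b : Fin n → Fin 4) : ℤ := ∏ i, pauliSign (a i) (b i)

theorem stringSign_eq {n : ℕ} (a b : Fin n → Fin 4) :
    stringSign a b = 1 ∨ stringSign a b = -1 := by
  unfold stringSign
  refine Finset.prod_induction _ (fun z : ℤ => z = 1 ∨ z = -1) ?_ (Or.inl rfl)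
    fun i _ => pauliSign_eq _ _
  rintro x y (rfl | rfl) (rfl | rfl) <;> simp

theorem pauliString_mul_comm {n : ℕ} (a b : Fin n → Fin 4) :
    pauliString a * pauliString b
      = (stringSign a b : ℂ) • (pauliString b * pauliString a) := by
  ext x y
  rw [Matrix.smul_apply, pauliString_mul_apply, pauliString_mul_apply]
  simp only [pauli_mul_comm (a _) (b _), Matrix.smul_apply, smul_eq_mul, Finset.prod_mul_distrib,
    stringSign, Int.cast_prod]

theorem exists_stringSign_ne {n : ℕ} {a b : Fin n → Fin 4} (h : a ≠ b) :
    ∃ c, stringSign c a ≠ stringSign c b := by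
  obtain ⟨i, hi⟩ := Function.ne_iff.mp h
  obtain ⟨z, hz⟩ := exists_pauliSign_ne hi
  -- The default value `0` labels the identity matrix, so only site `i` contributes to the sign.
  refine ⟨Pi.single i z, ?_⟩
  have key : ∀ d : Fin n → Fin 4, stringSign (Pi.single i z) d = pauliSign z (d i) := by
    intro d
    unfold stringSign
    rw [Finset.prod_eq_single i]
    · simp
    · intro j _ hj
      simp [Pi.single_eq_of_ne hj, pauliSign]
    · simp
  rwa [key, key]

theorem stringSign_zero_right {n : ℕ} (a : Fin n → Fin 4) : stringSign a 0 = 1 := by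
  simp [stringSign, pauliSign]

theorem stringSign_comm {n : ℕ} (a b : Fin n → Fin 4) : stringSign a b = stringSign b a := by
  unfold stringSign pauliSign
  refine Finset.prod_congr rfl fun i _ => ?_
  congr 1
  rw [eq_comm (a := a i) (b := b i)]
  exact propext ⟨fun h => by tauto, fun h => by tauto⟩

theorem pauliString_conj {n : ℕ} (c a : Fin n → Fin 4) :
    pauliString c * pauliString a * pauliString c = (stringSign c a : ℂ) • pauliString a := by
  rw [pauliString_mul_comm, smul_mul_assoc, mul_assoc, pauliString_sq, mul_one]

/-- Two non-identity Pauli strings have a common string anticommuting with both. -/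
theorem exists_stringSign_neg_neg {n : ℕ} {a b : Fin n → Fin 4} (ha : a ≠ 0) (hb : b ≠ 0) :
    ∃ c, stringSign c a = -1 ∧ stringSign c b = -1 := by
  have key : ∀ d : Fin n → Fin 4, d ≠ 0 → ∃ c, stringSign c d = -1 := by
    intro d hd
    obtain ⟨c, hc⟩ := exists_stringSign_ne hd
    rw [stringSign_zero_right] at hc
    exact ⟨c, (stringSign_eq c d).resolve_left hc⟩
  obtain ⟨c, hc⟩ := key a ha
  obtain ⟨d, hd⟩ := key b hb
  rcases stringSign_eq c b with hcb | hcb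
  · rcases stringSign_eq d a with hda | hda
    -- Here each of `c`, `d` anticommutes with exactly one of the two strings. Commutation signs are
    -- multiplicative, so the string `e` proportional to their product anticommutes with both.
    · obtain ⟨k, e, he⟩ := pauliString_mul c d
      have sign_mul : ∀ f, stringSign e f = stringSign c f * stringSign d f := by
        intro f
        have h1 : (pauliString c * pauliString d) * pauliString f
            = ((stringSign c f * stringSign d f : ℤ) : ℂ) •
              (pauliString f * (pauliString c * pauliString d)) := by
          rw [mul_assoc, pauliString_mul_comm d f, mul_smul_comm, ← mul_assoc,
            pauliString_mul_comm c f, smul_mul_assoc, smul_smul, mul_assoc]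
          push_cast
          rw [mul_comm]
        rw [he, smul_mul_assoc, pauliString_mul_comm e f, mul_smul_comm, smul_comm] at h1
        have h2 := sub_eq_zero.mpr h1
        rw [← sub_smul] at h2
        have h3 : Complex.I ^ k • (pauliString f * pauliString e) ≠ 0 := by
          intro h
          have h4 := (smul_eq_zero.mp h).resolve_left (pow_ne_zero _ Complex.I_ne_zero)
          have h5 : pauliString f * (pauliString f * pauliString e) * pauliString e = 0 := by
            rw [h4]; simp
          rw [← mul_assoc, pauliString_sq, one_mul, pauliString_sq] at h5
          exact one_ne_zero h5
        have h6 := (smul_eq_zero.mp h2).resolve_right h3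
        exact_mod_cast sub_eq_zero.mp h6
      exact ⟨e, by rw [sign_mul, hc, hda]; rfl, by rw [sign_mul, hcb, hd]; rfl⟩
    · exact ⟨d, hda, hd⟩
  · exact ⟨c, hc, hcb⟩

/-! ### Expansion in Pauli strings -/

theorem trace_one_op (n : ℕ) : (1 : Op n).trace = 2 ^ n := by
  simp [Matrix.trace_one]

theorem trace_pauliString_mul {n : ℕ} (a b : Fin n → Fin 4) :
    (pauliString a * pauliString b).trace = if a = b then (2 : ℂ) ^ n else 0 := by
  split_ifs with h
  · rw [h, pauliString_sq, trace_one_op]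
  · obtain ⟨c, hc⟩ := exists_stringSign_ne h
    -- Conjugation by `c` preserves the trace but flips its sign, because `c` anticommutes with
    -- exactly one of `a`, `b`.
    have h1 : (pauliString c * pauliString a * pauliString c *
        (pauliString c * pauliString b * pauliString c)).trace
        = (pauliString a * pauliString b).trace := by
      have h2 : pauliString c * pauliString a * pauliString c *
          (pauliString c * pauliString b * pauliString c)
          = pauliString c * (pauliString a * pauliString b) * pauliString c := by
        have h3 := pauliString_sq c
        calc _ = pauliString c * pauliString a * (pauliString c * pauliString c) *
              pauliString b * pauliString c := by noncomm_ring
          _ = _ := by rw [h3]; noncomm_ring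
      rw [h2, Matrix.trace_mul_cycle, pauliString_sq, one_mul]
    rw [pauliString_conj, pauliString_conj, smul_mul_smul_comm, Matrix.trace_smul] at h1
    rcases stringSign_eq c a with ha | ha <;> rcases stringSign_eq c b with hb | hb
    · exact absurd (ha.trans hb.symm) hc
    · simpa [ha, hb, neg_eq_self] using h1
    · simpa [ha, hb, neg_eq_self] using h1
    · exact absurd (ha.trans hb.symm) hc

theorem eq_sum_pauliString {n : ℕ} (X : Op n) :
    X = ∑ a : Fin n → Fin 4, ((pauliString a * X).trace / 2 ^ n) • pauliString a := by
  let F : Op n →ₗ[ℂ] Op n :=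
    { toFun := fun X => ∑ a : Fin n → Fin 4, ((pauliString a * X).trace / 2 ^ n) • pauliString a
      map_add' := fun X Y => by
        simp [mul_add, Matrix.trace_add, add_div, add_smul, Finset.sum_add_distrib]
      map_smul' := fun c X => by
        simp [Matrix.trace_smul, mul_div_assoc, Finset.smul_sum, smul_smul] }
  have h : LinearMap.id = F := by
    refine LinearMap.ext_on_range (span_pauliString n) fun b => ?_
    change pauliString b
      = ∑ a : Fin n → Fin 4, ((pauliString a * pauliString b).trace / 2 ^ n) • pauliString a
    simp only [trace_pauliString_mul, ite_div, zero_div, ite_smul, zero_smul]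
    simp
  exact LinearMap.congr_fun h X

theorem trace_mul_eq_sum {n : ℕ} (X Y : Op n) :
    (X * Y).trace
      = ∑ a : Fin n → Fin 4, (pauliString a * X).trace * (pauliString a * Y).trace / 2 ^ n := by
  conv_lhs => rw [eq_sum_pauliString X]
  rw [Finset.sum_mul, Matrix.trace_sum]
  refine Finset.sum_congr rfl fun a _ => ?_
  rw [smul_mul_assoc, Matrix.trace_smul, smul_eq_mul]
  ring

/-! ### Clifford unitaries -/

theorem exists_cliffordLayer {n : ℕ} (V : Op n) (hV : star V = V) (hVV : V * V = 1)
    (h : ∀ a, ∃ (k : ℕ) (b : Fin n → Fin 4),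
      V * pauliString a * V = Complex.I ^ k • pauliString b) :
    ∃ g : cliffordLayers n, ∀ X, (g : Op n ≃⋆ₐ[ℂ] Op n) X = V * X * V := by
  have hu : V ∈ Matrix.unitaryGroup (Bits n) ℂ := by
    rw [Matrix.mem_unitaryGroup_iff, hV, hVV]
  have hinv : ∀ W : UGroup n, ((⟨V, hu⟩ * W * (⟨V, hu⟩ : UGroup n)⁻¹ : UGroup n) : Op n)
      = V * W * V := by
    intro W
    rw [← Unitary.star_eq_inv]
    simp [hV]
  have hmem : ∀ W : UGroup n, W ∈ pauliGroup n →
      (⟨V, hu⟩ * W * (⟨V, hu⟩ : UGroup n)⁻¹ : UGroup n) ∈ pauliGroup n := by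
    rintro W ⟨k, a, hW⟩
    obtain ⟨l, b, hb⟩ := h a
    refine ⟨k + l, b, ?_⟩
    rw [hinv, hW, mul_smul_comm, smul_mul_assoc, hb, smul_smul, pow_add]
  have hC : (⟨V, hu⟩ : UGroup n) ∈ cliffordGroup n := by
    -- `V` is an involution, so conjugating twice returns `W` and the forward inclusion implies the
    -- converse.
    refine Subgroup.mem_set_normalizer_iff.mpr fun W => ⟨hmem W, fun hW => ?_⟩
    have h1 := hmem _ hW
    have h2 : (⟨V, hu⟩ * (⟨V, hu⟩ * W * (⟨V, hu⟩ : UGroup n)⁻¹) * (⟨V, hu⟩ : UGroup n)⁻¹ :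
        UGroup n) = W := by
      apply Subtype.ext
      rw [hinv, hinv]
      calc V * (V * (W : Op n) * V) * V = (V * V) * W * (V * V) := by noncomm_ring
        _ = W := by rw [hVV]; simp
    rwa [h2] at h1
  refine ⟨⟨_, Subgroup.mem_map_of_mem _ hC⟩, fun X => ?_⟩
  change V * X * star V = _
  rw [hV]

theorem exists_cliffordLayer_pauli {n : ℕ} (c : Fin n → Fin 4) :
    ∃ g : cliffordLayers n, ∀ a, (g : Op n ≃⋆ₐ[ℂ] Op n) (pauliString a)
      = (stringSign c a : ℂ) • pauliString a := by
  obtain ⟨g, hg⟩ := exists_cliffordLayer (pauliString c) (pauliString_star c) (pauliString_sq c)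
    fun a => by
      rw [pauliString_conj]
      rcases stringSign_eq c a with h | h
      · exact ⟨0, a, by simp [h]⟩
      · exact ⟨2, a, by simp [h]⟩
  exact ⟨g, fun a => by rw [hg, pauliString_conj]⟩

/-- For signs `x`, `y` only one term survives: a multiple of `Q` if they agree, of `Q A B` if they
differ. This shows both that `(A + B) / √2` is Clifford and that it exchanges `A` and `B`. -/
theorem add_mul_mul_add {n : ℕ} {A B Q : Op n} {x y : ℂ} (hA : A * A = 1) (hB : B * B = 1)
    (hAB : B * A = -(A * B)) (hx : A * Q = x • (Q * A)) (hy : B * Q = y • (Q * B)) :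
    (A + B) * Q * (A + B) = (x + y) • Q + (x - y) • (Q * (A * B)) := by
  calc (A + B) * Q * (A + B) = (A * Q) * A + (A * Q) * B + (B * Q) * A + (B * Q) * B := by
        noncomm_ring
    _ = x • (Q * (A * A)) + x • (Q * (A * B)) + y • (Q * (B * A)) + y • (Q * (B * B)) := by
        rw [hx, hy]; simp only [smul_mul_assoc, mul_assoc]
    _ = _ := by
        rw [hA, hB, hAB, mul_one, mul_neg, smul_neg, add_smul, sub_smul]
        abel

/-- Anticommuting Pauli strings `P`, `Q` are exchanged by the Clifford unitary `(P + Q) / √2`. -/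
theorem exists_cliffordLayer_swap {n : ℕ} {a b : Fin n → Fin 4} (h : stringSign a b = -1) :
    ∃ g : cliffordLayers n, (g : Op n ≃⋆ₐ[ℂ] Op n) (pauliString a) = pauliString b := by
  set A := pauliString a with hA
  set B := pauliString b with hB
  have hAA : A * A = 1 := pauliString_sq a
  have hBB : B * B = 1 := pauliString_sq b
  have hAB : B * A = -(A * B) := by
    rw [hA, hB, pauliString_mul_comm, stringSign_comm, h]; simp
  obtain ⟨r, hrr, hr⟩ : ∃ r : ℂ, r * r = 1 / 2 ∧ star r = r := by
    refine ⟨(((√2)⁻¹ : ℝ) : ℂ), ?_, Complex.conj_ofReal _⟩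
    rw [← Complex.ofReal_mul, ← mul_inv, Real.mul_self_sqrt (by norm_num)]; norm_num
  have hconj : ∀ Q, (r • (A + B)) * Q * (r • (A + B)) = (1 / 2 : ℂ) • ((A + B) * Q * (A + B)) := by
    intro Q
    rw [smul_mul_assoc, smul_mul_smul_comm, hrr]
  have hex : ∃ g : cliffordLayers n, ∀ X, (g : Op n ≃⋆ₐ[ℂ] Op n) X
      = (r • (A + B)) * X * (r • (A + B)) := by
    refine exists_cliffordLayer (r • (A + B)) ?_ ?_ ?_
    · rw [star_smul, star_add, hA, hB, pauliString_star, pauliString_star, hr]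
    · have := hconj 1
      rw [mul_one, mul_one] at this
      rw [this, add_mul, mul_add, mul_add, hAA, hBB, hAB]
      rw [show (1 + A * B + (-(A * B) + 1) : Op n) = (2 : ℂ) • 1 by rw [two_smul]; abel, smul_smul]
      norm_num
    · intro c
      have hx := pauliString_mul_comm a c
      have hy := pauliString_mul_comm b c
      obtain ⟨k, d, hd⟩ := pauliString_mul a b
      obtain ⟨l, e, he⟩ := pauliString_mul c d
      have hCAB : pauliString c * (A * B) = Complex.I ^ (k + l) • pauliString e := by
        rw [hd, mul_smul_comm, he, smul_smul, pow_add]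
      rw [hconj, add_mul_mul_add hAA hBB hAB hx hy]
      rcases stringSign_eq a c with h1 | h1 <;> rcases stringSign_eq b c with h2 | h2
      · refine ⟨0, c, ?_⟩
        rw [h1, h2, smul_add, smul_smul, smul_smul]; norm_num
      · refine ⟨k + l, e, ?_⟩
        rw [h1, h2, smul_add, smul_smul, smul_smul, hCAB]; norm_num
      · refine ⟨2 + (k + l), e, ?_⟩
        rw [h1, h2, smul_add, smul_smul, smul_smul, hCAB,
          pow_add Complex.I 2, mul_smul]; norm_num
      · refine ⟨2, c, ?_⟩
        rw [h1, h2, smul_add, smul_smul, smul_smul]; norm_num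
  obtain ⟨g, hg⟩ := hex
  refine ⟨g, ?_⟩
  rw [hg, hconj, add_mul_mul_add (x := 1) (y := -1) hAA hBB hAB (by simp)
    (by rw [hAB]; simp)]
  rw [← mul_assoc, hAA, one_mul, smul_add, smul_smul, smul_smul]
  norm_num

theorem exists_cliffordLayer_map {n : ℕ} {a b : Fin n → Fin 4} (ha : a ≠ 0) (hb : b ≠ 0) :
    ∃ g : cliffordLayers n, (g : Op n ≃⋆ₐ[ℂ] Op n) (pauliString a) = pauliString b := by
  obtain ⟨c, hca, hcb⟩ := exists_stringSign_neg_neg ha hb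
  obtain ⟨g, hg⟩ := exists_cliffordLayer_swap ((stringSign_comm a c).trans hca)
  obtain ⟨h, hh⟩ := exists_cliffordLayer_swap hcb
  refine ⟨h * g, ?_⟩
  change (h : Op n ≃⋆ₐ[ℂ] Op n) ((g : Op n ≃⋆ₐ[ℂ] Op n) (pauliString a)) = _
  rw [hg, hh]

theorem trace_cliffordLayer {n : ℕ} (g : cliffordLayers n) (X : Op n) :
    ((g : Op n ≃⋆ₐ[ℂ] Op n) X).trace = X.trace := by
  obtain ⟨g, C, -, rfl⟩ := g
  change ((C : Op n) * X * star (C : Op n)).trace = _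
  rw [Matrix.trace_mul_cycle, Unitary.coe_star_mul_self, one_mul]

/-! ### Twirling over the Clifford group -/

/-- The average of a bilinear form over the Clifford group. -/
noncomputable def twirl {n : ℕ} (B : Op n →ₗ[ℂ] Op n →ₗ[ℂ] ℂ) : Op n →ₗ[ℂ] Op n →ₗ[ℂ] ℂ :=
  (Fintype.card (cliffordLayers n) : ℂ)⁻¹ • ∑ g : cliffordLayers n,
    B.compl₁₂ ((g : Op n ≃⋆ₐ[ℂ] Op n) : Op n →ₗ[ℂ] Op n)
      ((g : Op n ≃⋆ₐ[ℂ] Op n) : Op n →ₗ[ℂ] Op n)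

theorem twirl_apply {n : ℕ} (B : Op n →ₗ[ℂ] Op n →ₗ[ℂ] ℂ) (X Y : Op n) :
    twirl B X Y = 𝔼 g : cliffordLayers n,
      B ((g : Op n ≃⋆ₐ[ℂ] Op n) X) ((g : Op n ≃⋆ₐ[ℂ] Op n) Y) := by
  rw [Fintype.expect_eq_sum_div_card, div_eq_inv_mul]
  simp [twirl, LinearMap.sum_apply, LinearMap.smul_apply]

theorem twirl_map {n : ℕ} (B : Op n →ₗ[ℂ] Op n →ₗ[ℂ] ℂ) (h : cliffordLayers n) (X Y : Op n) :
    twirl B ((h : Op n ≃⋆ₐ[ℂ] Op n) X) ((h : Op n ≃⋆ₐ[ℂ] Op n) Y) = twirl B X Y := by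
  rw [twirl_apply, twirl_apply]
  exact Fintype.expect_equiv (Equiv.mulRight h) _ _ fun g => rfl

theorem twirl_pauliString_of_ne {n : ℕ} (B : Op n →ₗ[ℂ] Op n →ₗ[ℂ] ℂ) {a b : Fin n → Fin 4}
    (h : a ≠ b) : twirl B (pauliString a) (pauliString b) = 0 := by
  obtain ⟨c, hc⟩ := exists_stringSign_ne h
  obtain ⟨g, hg⟩ := exists_cliffordLayer_pauli c
  have h1 := twirl_map B g (pauliString a) (pauliString b)
  rw [hg, hg] at h1
  rcases stringSign_eq c a with ha | ha <;> rcases stringSign_eq c b with hb | hb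
  · exact absurd (ha.trans hb.symm) hc
  · simpa [ha, hb, neg_eq_self] using h1
  · simpa [ha, hb, neg_eq_self] using h1
  · exact absurd (ha.trans hb.symm) hc

theorem twirl_pauliString_self {n : ℕ} (B : Op n →ₗ[ℂ] Op n →ₗ[ℂ] ℂ) {a b : Fin n → Fin 4}
    (ha : a ≠ 0) (hb : b ≠ 0) :
    twirl B (pauliString a) (pauliString a) = twirl B (pauliString b) (pauliString b) := by
  obtain ⟨g, hg⟩ := exists_cliffordLayer_map ha hb
  rw [← hg, twirl_map]

/-- The factor by which a twirled bilinear form differs from the trace form on traceless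
operators. -/
noncomputable def twirlCoeff {n : ℕ} (B : Op n →ₗ[ℂ] Op n →ₗ[ℂ] ℂ) : ℂ :=
  (∑ a : Fin n → Fin 4 with a ≠ 0, twirl B (pauliString a) (pauliString a))
    / (2 ^ n * (4 ^ n - 1))

theorem four_pow_sub_one_ne_zero {n : ℕ} (hn : 1 ≤ n) : (4 : ℂ) ^ n - 1 ≠ 0 := by
  have h : (4 : ℕ) ^ n ≠ 1 := (Nat.one_lt_pow (by omega) (by norm_num)).ne'
  exact sub_ne_zero.mpr (by exact_mod_cast h)

theorem twirl_pauliString {n : ℕ} (hn : 1 ≤ n) (B : Op n →ₗ[ℂ] Op n →ₗ[ℂ] ℂ)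
    {a : Fin n → Fin 4} (ha : a ≠ 0) :
    twirl B (pauliString a) (pauliString a) = twirlCoeff B * 2 ^ n := by
  have h4 := four_pow_sub_one_ne_zero hn
  have hcard : ((Finset.univ.filter fun b : Fin n → Fin 4 => b ≠ 0).card : ℂ) = 4 ^ n - 1 := by
    rw [Finset.filter_ne', Finset.card_erase_of_mem (Finset.mem_univ _), Finset.card_univ,
      Nat.cast_sub Fintype.card_pos]
    simp
  have hsum : ∑ b : Fin n → Fin 4 with b ≠ 0, twirl B (pauliString b) (pauliString b)
      = (4 ^ n - 1) * twirl B (pauliString a) (pauliString a) := by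
    rw [Finset.sum_congr rfl fun b hb =>
      twirl_pauliString_self B (Finset.mem_filter.mp hb).2 ha, Finset.sum_const, nsmul_eq_mul,
      hcard]
  rw [twirlCoeff, hsum]
  field_simp

theorem twirl_eq {n : ℕ} (hn : 1 ≤ n) (B : Op n →ₗ[ℂ] Op n →ₗ[ℂ] ℂ) {X Y : Op n}
    (hX : X.trace = 0) : twirl B X Y = twirlCoeff B * (X * Y).trace := by
  conv_lhs => rw [eq_sum_pauliString X, eq_sum_pauliString Y]
  rw [trace_mul_eq_sum, Finset.mul_sum, map_sum (twirl B), LinearMap.sum_apply]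
  refine Finset.sum_congr rfl fun a _ => ?_
  rw [map_sum, Finset.sum_eq_single a]
  · rw [map_smul, map_smul, LinearMap.smul_apply, smul_eq_mul, smul_eq_mul]
    -- The identity string has coefficient proportional to `tr X = 0`, so the value of the twirl
    -- there is irrelevant and `Y` may have any trace.
    by_cases ha : a = 0
    · have h0 : (pauliString a * X).trace = 0 := by
        rw [ha]
        change (pauliString (fun _ => 0) * X).trace = 0
        rw [← pauliString_one, one_mul, hX]
      simp [h0]
    · rw [twirl_pauliString hn B ha]
      field_simp
  · intro b _ hb
    rw [map_smul, map_smul, LinearMap.smul_apply, twirl_pauliString_of_ne B hb.symm]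
    simp
  · simp

/-- The bilinear form `(X, Y) ↦ tr[Λ₁(X) Λ₂(Y)]`. -/
noncomputable def traceForm {n : ℕ} (Λ₁ Λ₂ : Op n →ₗ[ℂ] Op n) : Op n →ₗ[ℂ] Op n →ₗ[ℂ] ℂ :=
  ((LinearMap.mul ℂ (Op n)).compr₂ (Matrix.traceLinearMap (Bits n) ℂ ℂ)).compl₁₂ Λ₁ Λ₂

theorem traceForm_apply {n : ℕ} (Λ₁ Λ₂ : Op n →ₗ[ℂ] Op n) (X Y : Op n) :
    traceForm Λ₁ Λ₂ X Y = (Λ₁ X * Λ₂ Y).trace := rfl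

/-- The linear functional `X ↦ tr[X O]`. -/
noncomputable def traceMul {n : ℕ} (O : Op n) : Op n →ₗ[ℂ] ℂ :=
  Matrix.traceLinearMap (Bits n) ℂ ℂ ∘ₗ LinearMap.mulRight ℂ O

/-- The bilinear form `(X, Y) ↦ tr[X O] tr[Y O]`. -/
noncomputable def observableForm {n : ℕ} (O : Op n) : Op n →ₗ[ℂ] Op n →ₗ[ℂ] ℂ :=
  (LinearMap.mul ℂ ℂ).compl₁₂ (traceMul O) (traceMul O)

theorem observableForm_apply {n : ℕ} (O X Y : Op n) :
    observableForm O X Y = (X * O).trace * (Y * O).trace := rfl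

/-- As `O` is traceless, the identity string may be added to the sum defining the coefficient. For
each Clifford, moving it from the strings onto `O` turns the full sum into Parseval's identity
`trace_mul_eq_sum`. -/
theorem twirlCoeff_observableForm {n : ℕ} {O : Op n} (hO : O.trace = 0) :
    twirlCoeff (observableForm O) = (O * O).trace / (4 ^ n - 1) := by
  have h0 : twirl (observableForm O) (pauliString 0) (pauliString 0) = 0 := by
    have h1 : (pauliString 0 : Op n) = 1 := pauliString_one.symm
    rw [twirl_apply, h1]
    simp [observableForm_apply, hO]
  have h1 : ∑ a : Fin n → Fin 4 with a ≠ 0,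
      twirl (observableForm O) (pauliString a) (pauliString a)
      = ∑ a, twirl (observableForm O) (pauliString a) (pauliString a) := by
    rw [Finset.sum_filter]
    refine Finset.sum_congr rfl fun a _ => ?_
    split_ifs with h
    · rfl
    · rw [not_not.mp h, h0]
  have h2 : ∀ g : cliffordLayers n, ∑ a : Fin n → Fin 4, observableForm O
      ((g : Op n ≃⋆ₐ[ℂ] Op n) (pauliString a)) ((g : Op n ≃⋆ₐ[ℂ] Op n) (pauliString a))
      = 2 ^ n * (O * O).trace := by
    intro g
    set O' := (g : Op n ≃⋆ₐ[ℂ] Op n).symm O with hO'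
    have hOO : O = (g : Op n ≃⋆ₐ[ℂ] Op n) O' := by simp [hO']
    have h3 : (O * O).trace = (O' * O').trace := by
      rw [hOO, ← map_mul, trace_cliffordLayer]
    rw [h3, trace_mul_eq_sum, Finset.mul_sum]
    refine Finset.sum_congr rfl fun a _ => ?_
    rw [observableForm_apply, hOO, ← map_mul, trace_cliffordLayer]
    field_simp
  rw [twirlCoeff, h1]
  simp only [twirl_apply]
  rw [← Finset.expect_sum_comm, Finset.expect_congr rfl fun g _ => h2 g, Fintype.expect_const]
  field_simp

/-! ### Twirling over the unitary group -/

/-- The unitary channel of `V` as a linear map. -/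
noncomputable def unitaryMap {n : ℕ} (V : UGroup n) : Op n →ₗ[ℂ] Op n :=
  (Unitary.conjStarAlgAut ℂ (Op n) V : Op n →ₗ[ℂ] Op n)

theorem unitaryMap_apply {n : ℕ} (V : UGroup n) (X : Op n) :
    unitaryMap V X = unitaryChannel V X := rfl

theorem unitaryMap_mul {n : ℕ} (V W : UGroup n) (X : Op n) :
    unitaryMap (V * W) X = unitaryMap V (unitaryMap W X) :=
  Unitary.conjStarAlgAut_mul_apply (S := ℂ) V W X

theorem unitaryMap_map_mul {n : ℕ} (V : UGroup n) (X Y : Op n) :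
    unitaryMap V (X * Y) = unitaryMap V X * unitaryMap V Y :=
  map_mul (Unitary.conjStarAlgAut ℂ (Op n) V) X Y

theorem trace_unitaryMap {n : ℕ} (V : UGroup n) (X : Op n) :
    (unitaryMap V X).trace = X.trace := by
  change ((V : Op n) * X * star (V : Op n)).trace = _
  rw [Matrix.trace_mul_cycle, Unitary.coe_star_mul_self, one_mul]

instance isProbabilityMeasure_haarU (n : ℕ) : MeasureTheory.IsProbabilityMeasure (haarU n) :=
  ⟨MeasureTheory.Measure.haarMeasure_self
    (K₀ := (⊤ : TopologicalSpace.PositiveCompacts (UGroup n)))⟩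

instance isHaarMeasure_haarU (n : ℕ) : (haarU n).IsHaarMeasure :=
  MeasureTheory.Measure.isHaarMeasure_haarMeasure ⊤

theorem continuous_bilinear_diag {n : ℕ} (B : Op n →ₗ[ℂ] Op n →ₗ[ℂ] ℂ) :
    Continuous fun X : Op n => B X X := by
  have h : (fun X : Op n => B X X) = fun X : Op n => ∑ a : Fin n → Fin 4,
      ((pauliString a * X).trace / 2 ^ n) * B (pauliString a) X := by
    funext X
    have h1 : B X = ∑ a : Fin n → Fin 4,
        ((pauliString a * X).trace / 2 ^ n) • B (pauliString a) := by
      conv_lhs => rw [eq_sum_pauliString X, map_sum]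
      simp only [map_smul]
    rw [h1, LinearMap.sum_apply]
    rfl
  rw [h]
  refine continuous_finsetSum _ fun a _ => Continuous.mul ?_ ?_
  · fun_prop
  · exact LinearMap.continuous_of_finiteDimensional _

theorem integrable_bilinear_unitaryMap {n : ℕ} (B : Op n →ₗ[ℂ] Op n →ₗ[ℂ] ℂ) (X : Op n) :
    MeasureTheory.Integrable (fun V => B (unitaryMap V X) (unitaryMap V X)) (haarU n) := by
  refine Continuous.integrable_of_hasCompactSupport ?_ (HasCompactSupport.of_compactSpace _)
  refine (continuous_bilinear_diag B).comp ?_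
  change Continuous fun V : UGroup n => (V : Op n) * X * star (V : Op n)
  fun_prop

theorem integral_bilinear_unitaryMap_mul {n : ℕ} (B : Op n →ₗ[ℂ] Op n →ₗ[ℂ] ℂ) (W : UGroup n)
    (X : Op n) :
    ∫ V, B (unitaryMap W (unitaryMap V X)) (unitaryMap W (unitaryMap V X)) ∂(haarU n)
      = ∫ V, B (unitaryMap V X) (unitaryMap V X) ∂(haarU n) := by
  have h := MeasureTheory.integral_mul_left_eq_self (μ := haarU n)
    (fun V => B (unitaryMap V X) (unitaryMap V X)) W
  simpa only [unitaryMap_mul] using h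

/-- Left invariance allows `B` to be replaced by its Clifford twirl under the integral, and the
twirled integrand does not depend on `V`. -/
theorem integral_bilinear_unitaryMap {n : ℕ} (hn : 1 ≤ n) (B : Op n →ₗ[ℂ] Op n →ₗ[ℂ] ℂ)
    {X : Op n} (hX : X.trace = 0) :
    ∫ V, B (unitaryMap V X) (unitaryMap V X) ∂(haarU n) = twirlCoeff B * (X * X).trace := by
  have hg : ∀ g : cliffordLayers n, ∃ W : UGroup n,
      ((g : Op n ≃⋆ₐ[ℂ] Op n) : Op n →ₗ[ℂ] Op n) = unitaryMap W := by
    rintro ⟨g, C, -, rfl⟩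
    exact ⟨C, rfl⟩
  choose W hW using hg
  have h1 : ∀ V, twirl B (unitaryMap V X) (unitaryMap V X) = twirlCoeff B * (X * X).trace := by
    intro V
    rw [twirl_eq hn B ((trace_unitaryMap V X).trans hX), ← unitaryMap_map_mul, trace_unitaryMap]
  have h2 : ∫ V, twirl B (unitaryMap V X) (unitaryMap V X) ∂(haarU n)
      = ∫ V, B (unitaryMap V X) (unitaryMap V X) ∂(haarU n) := by
    have h3 : ∀ V, twirl B (unitaryMap V X) (unitaryMap V X)
        = (Fintype.card (cliffordLayers n) : ℂ)⁻¹ * ∑ g : cliffordLayers n,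
          B (unitaryMap (W g) (unitaryMap V X)) (unitaryMap (W g) (unitaryMap V X)) := by
      intro V
      rw [twirl, LinearMap.smul_apply, LinearMap.smul_apply, LinearMap.sum_apply,
        LinearMap.sum_apply, smul_eq_mul]
      simp only [hW, LinearMap.compl₁₂_apply]
    simp only [h3]
    rw [MeasureTheory.integral_const_mul, MeasureTheory.integral_finsetSum]
    · simp only [integral_bilinear_unitaryMap_mul]
      simp
    · intro g _
      have h4 := integrable_bilinear_unitaryMap (B.compl₁₂ (unitaryMap (W g)) (unitaryMap (W g))) X
      exact h4
  rw [← h2]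
  simp [h1]

theorem exists_traceless_op {n : ℕ} (hn : 1 ≤ n) :
    ∃ X : Op n, X.trace = 0 ∧ (X * X).trace = 2 ^ n := by
  have ha : (fun _ => 1 : Fin n → Fin 4) ≠ fun _ => 0 := fun h => by
    simpa using congrFun h ⟨0, hn⟩
  refine ⟨pauliString fun _ => 1, ?_, by rw [pauliString_sq, trace_one_op]⟩
  have h := trace_pauliString_mul (fun _ => 1 : Fin n → Fin 4) (fun _ => 0)
  rwa [← pauliString_one, mul_one, if_neg ha] at h

/-- Haar invariance absorbs `W`; evaluating at a traceless operator with `tr[X²] ≠ 0` recovers the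
coefficient. This removes the layer `U` from the problem. -/
theorem twirlCoeff_comp_unitaryMap {n : ℕ} (hn : 1 ≤ n) (B : Op n →ₗ[ℂ] Op n →ₗ[ℂ] ℂ)
    (W : UGroup n) :
    twirlCoeff (B.compl₁₂ (unitaryMap W) (unitaryMap W)) = twirlCoeff B := by
  obtain ⟨X, h0, hX⟩ := exists_traceless_op hn
  have h1 := integral_bilinear_unitaryMap hn B h0
  rw [← integral_bilinear_unitaryMap_mul B W] at h1
  have h2 := integral_bilinear_unitaryMap hn (B.compl₁₂ (unitaryMap W) (unitaryMap W)) h0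
  simp only [LinearMap.compl₁₂_apply] at h2
  rw [h1, hX] at h2
  exact (mul_right_cancel₀ (pow_ne_zero n two_ne_zero) h2).symm

theorem twirlCoeff_traceForm_id {n : ℕ} (hn : 1 ≤ n) :
    twirlCoeff (traceForm LinearMap.id LinearMap.id : Op n →ₗ[ℂ] Op n →ₗ[ℂ] ℂ) = 1 := by
  obtain ⟨X, h0, hX⟩ := exists_traceless_op hn
  have h1 := integral_bilinear_unitaryMap hn (traceForm LinearMap.id LinearMap.id) h0
  simp only [traceForm_apply, LinearMap.id_apply, ← unitaryMap_map_mul, trace_unitaryMap, hX,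
    MeasureTheory.integral_const, MeasureTheory.probReal_univ, one_smul] at h1
  exact (mul_eq_right₀ (pow_ne_zero n two_ne_zero)).mp h1.symm

/-! ### Unital noise -/

/-- Unital, trace preserving and Hermiticity preserving maps. -/
structure IsUnitalTP {n : ℕ} (Λ : Op n →ₗ[ℂ] Op n) : Prop where
  map_one : Λ 1 = 1
  trace_map : ∀ X, (Λ X).trace = X.trace
  map_conjTranspose : ∀ X, Λ Xᴴ = (Λ X)ᴴ

theorem IsUnitalTP.id {n : ℕ} : IsUnitalTP (LinearMap.id : Op n →ₗ[ℂ] Op n) :=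
  ⟨rfl, fun _ => rfl, fun _ => rfl⟩

theorem IsUnitalTP.unitaryMap {n : ℕ} (V : UGroup n) : IsUnitalTP (unitaryMap V) :=
  ⟨_root_.map_one (Unitary.conjStarAlgAut ℂ (Op n) V), trace_unitaryMap V,
    map_star (Unitary.conjStarAlgAut ℂ (Op n) V)⟩

theorem IsUnitalTP.comp {n : ℕ} {Λ₁ Λ₂ : Op n →ₗ[ℂ] Op n} (h₁ : IsUnitalTP Λ₁)
    (h₂ : IsUnitalTP Λ₂) : IsUnitalTP (Λ₁ ∘ₗ Λ₂) :=
  ⟨by simp [h₁.map_one, h₂.map_one], fun X => by simp [h₁.trace_map, h₂.trace_map],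
    fun X => by simp [h₁.map_conjTranspose, h₂.map_conjTranspose]⟩

theorem IsChannel.isUnitalTP {n : ℕ} {N : Op n →ₗ[ℂ] Op n} (hN : IsChannel N) (h1 : N 1 = 1) :
    IsUnitalTP N := by
  obtain ⟨r, E, hE, hN⟩ := hN
  refine ⟨h1, fun X => ?_, fun X => ?_⟩
  · rw [hN, Matrix.trace_sum]
    simp only [Matrix.trace_mul_cycle _ X]
    rw [← Matrix.trace_sum, ← Finset.sum_mul, hE, one_mul]
  · rw [hN, hN, Matrix.conjTranspose_sum]
    simp [Matrix.conjTranspose_mul, mul_assoc]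

theorem Matrix.IsHermitian.trace_mul_re {n : ℕ} {A B : Op n} (hA : A.IsHermitian)
    (hB : B.IsHermitian) : (((A * B).trace.re : ℝ) : ℂ) = (A * B).trace := by
  rw [← Complex.conj_eq_iff_re, starRingEnd_apply, ← Matrix.trace_conjTranspose,
    Matrix.conjTranspose_mul, hA.eq, hB.eq, Matrix.trace_mul_comm]

theorem IsUnitalTP.isHermitian_map {n : ℕ} {Λ : Op n →ₗ[ℂ] Op n} (h : IsUnitalTP Λ) {X : Op n}
    (hX : X.IsHermitian) : (Λ X).IsHermitian := by
  rw [Matrix.IsHermitian, ← h.map_conjTranspose, hX.eq]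

theorem IsUnitalTP.map_add_smul_one {n : ℕ} {Λ : Op n →ₗ[ℂ] Op n} (h : IsUnitalTP Λ) (X : Op n)
    (c : ℂ) : Λ (X + c • 1) = Λ X + c • 1 := by
  rw [map_add, map_smul, h.map_one]

/-- The traceless part of an operator of unit trace. -/
noncomputable def tracelessPart {n : ℕ} (X : Op n) : Op n := X - ((2 : ℂ) ^ n)⁻¹ • 1

theorem tracelessPart_add {n : ℕ} (X : Op n) : tracelessPart X + ((2 : ℂ) ^ n)⁻¹ • 1 = X :=
  sub_add_cancel _ _

theorem trace_tracelessPart {n : ℕ} {X : Op n} (hX : X.trace = 1) :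
    (tracelessPart X).trace = 0 := by
  simp [tracelessPart, Matrix.trace_sub, Matrix.trace_smul, hX]

theorem trace_add_smul_mul_add_smul {n : ℕ} {X Y : Op n} (hX : X.trace = 0) (hY : Y.trace = 0) :
    ((X + ((2 : ℂ) ^ n)⁻¹ • 1) * (Y + ((2 : ℂ) ^ n)⁻¹ • 1)).trace
      = (X * Y).trace + ((2 : ℂ) ^ n)⁻¹ := by
  simp [add_mul, mul_add, Matrix.trace_add, Matrix.trace_smul, hX, hY]

theorem trace_tracelessPart_mul_self {n : ℕ} {X : Op n} (hX : X.trace = 1) :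
    (tracelessPart X * tracelessPart X).trace = (X * X).trace - ((2 : ℂ) ^ n)⁻¹ := by
  have h := trace_tracelessPart hX
  rw [eq_sub_iff_add_eq, ← trace_add_smul_mul_add_smul h h, tracelessPart_add]

/-- Splitting off the maximally mixed part of the pure state contributes the constant `1 / 2^n`,
which is subtracted. The traceless part has squared norm `1 - 1 / 2^n`, which cancels the prefactor.
-/
theorem twirlCoeff_traceForm_eq {n : ℕ} (hn : 1 ≤ n) {ψ : Bits n → ℂ} (hψ : star ψ ⬝ᵥ ψ = 1)
    {Λ₁ Λ₂ : Op n →ₗ[ℂ] Op n} (h₁ : IsUnitalTP Λ₁) (h₂ : IsUnitalTP Λ₂) :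
    ((2 ^ n / (2 ^ n - 1) * ((∫ V, (Λ₁ (unitaryChannel V (proj ψ))
      * Λ₂ (unitaryChannel V (proj ψ))).trace.re ∂(haarU n)) - 1 / 2 ^ n) : ℝ) : ℂ)
      = twirlCoeff (traceForm Λ₁ Λ₂) := by
  have hpH : (proj ψ).IsHermitian := by
    rw [Matrix.IsHermitian, proj, Matrix.conjTranspose_vecMulVec, star_star]
  have hp1 : (proj ψ).trace = 1 := by
    rw [proj, Matrix.trace_vecMulVec, dotProduct_comm, hψ]
  have hpp : proj ψ * proj ψ = proj ψ := by
    rw [proj, Matrix.vecMulVec_mul_vecMulVec, hψ, one_smul]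
  have h0 := trace_tracelessPart hp1
  have hpt : ∀ V, (((Λ₁ (unitaryChannel V (proj ψ))
      * Λ₂ (unitaryChannel V (proj ψ))).trace.re : ℝ) : ℂ)
      = traceForm Λ₁ Λ₂ (unitaryMap V (tracelessPart (proj ψ)))
          (unitaryMap V (tracelessPart (proj ψ))) + ((2 : ℂ) ^ n)⁻¹ := by
    intro V
    have hV := IsUnitalTP.unitaryMap V
    rw [← unitaryMap_apply, Matrix.IsHermitian.trace_mul_re
      (h₁.isHermitian_map (hV.isHermitian_map hpH)) (h₂.isHermitian_map (hV.isHermitian_map hpH)),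
      traceForm_apply, ← trace_add_smul_mul_add_smul
        (by rw [h₁.trace_map, hV.trace_map, h0]) (by rw [h₂.trace_map, hV.trace_map, h0]),
      ← h₁.map_add_smul_one, ← h₂.map_add_smul_one, ← hV.map_add_smul_one, tracelessPart_add]
  have hd : (2 : ℂ) ^ n - 1 ≠ 0 := by
    have h : (2 : ℕ) ^ n ≠ 1 := (Nat.one_lt_pow (by omega) (by norm_num)).ne'
    exact sub_ne_zero.mpr (by exact_mod_cast h)
  push_cast
  rw [← integral_complex_ofReal]
  simp only [hpt]
  rw [MeasureTheory.integral_add (integrable_bilinear_unitaryMap _ _)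
    (MeasureTheory.integrable_const _), integral_bilinear_unitaryMap hn _ h0,
    trace_tracelessPart_mul_self hp1, hpp, hp1]
  simp
  field_simp

/-! ### Random circuits -/

theorem trace_circuitOutput {n : ℕ} {Λ : Op n →ₗ[ℂ] Op n} (h : IsUnitalTP Λ) (X : Op n) :
    ∀ (L : ℕ) (C : Fin (L + 1) → cliffordLayers n), (circuitOutput Λ X L C).trace = X.trace
  | 0, C => trace_cliffordLayer _ _
  | L + 1, C => by
    rw [circuitOutput, trace_cliffordLayer, h.trace_map, trace_circuitOutput h X L]

theorem isHermitian_circuitOutput {n : ℕ} {Λ : Op n →ₗ[ℂ] Op n} (h : IsUnitalTP Λ) {X : Op n}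
    (hX : X.IsHermitian) :
    ∀ (L : ℕ) (C : Fin (L + 1) → cliffordLayers n), (circuitOutput Λ X L C).IsHermitian
  | 0, C => IsSelfAdjoint.map hX (C 0 : Op n ≃⋆ₐ[ℂ] Op n)
  | L + 1, C => IsSelfAdjoint.map (h.isHermitian_map (isHermitian_circuitOutput h hX L _))
      (C (Fin.last (L + 1)) : Op n ≃⋆ₐ[ℂ] Op n)

theorem circuitOutput_add_smul_one {n : ℕ} {Λ : Op n →ₗ[ℂ] Op n} (h : IsUnitalTP Λ) (X : Op n)
    (c : ℂ) : ∀ (L : ℕ) (C : Fin (L + 1) → cliffordLayers n),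
      circuitOutput Λ (X + c • 1) L C = circuitOutput Λ X L C + c • 1
  | 0, C => by rw [circuitOutput, circuitOutput, map_add, map_smul, map_one]
  | L + 1, C => by
    rw [circuitOutput, circuitOutput, circuitOutput_add_smul_one h X c L, h.map_add_smul_one,
      map_add, map_smul, map_one]

/-- Averaging the last Clifford turns `B` into a multiple of the trace form after one more noise
layer. The outer form thus changes at each step, hence the induction over all `B`. -/
theorem expect_circuitOutput {n : ℕ} (hn : 1 ≤ n) {Λ₁ Λ₂ : Op n →ₗ[ℂ] Op n}
    (h₁ : IsUnitalTP Λ₁) {X Y : Op n} (hX : X.trace = 0) (L : ℕ)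
    (B : Op n →ₗ[ℂ] Op n →ₗ[ℂ] ℂ) :
    𝔼 C : Fin (L + 1) → cliffordLayers n, B (circuitOutput Λ₁ X L C) (circuitOutput Λ₂ Y L C)
      = twirlCoeff B * twirlCoeff (traceForm Λ₁ Λ₂) ^ L * (X * Y).trace := by
  induction L generalizing B with
  | zero =>
    rw [pow_zero, mul_one, ← twirl_eq hn B hX, twirl_apply]
    exact Fintype.expect_equiv (Equiv.funUnique (Fin 1) (cliffordLayers n)) _ _ fun C => rfl
  | succ L ih =>
    have h := Fintype.expect_equiv (Fin.snocEquiv fun _ : Fin (L + 1 + 1) => cliffordLayers n)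
      (fun p => B
        ((p.1 : Op n ≃⋆ₐ[ℂ] Op n) (Λ₁ (circuitOutput Λ₁ X L p.2)))
        ((p.1 : Op n ≃⋆ₐ[ℂ] Op n) (Λ₂ (circuitOutput Λ₂ Y L p.2))))
      (fun C => B (circuitOutput Λ₁ X (L + 1) C) (circuitOutput Λ₂ Y (L + 1) C))
      (fun p => by simp [circuitOutput, Fin.snocEquiv])
    rw [← h, ← Finset.univ_product_univ, Finset.expect_product, Finset.expect_comm]
    have h2 : ∀ C : Fin (L + 1) → cliffordLayers n, 𝔼 g : cliffordLayers n,
        B ((g : Op n ≃⋆ₐ[ℂ] Op n) (Λ₁ (circuitOutput Λ₁ X L C)))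
          ((g : Op n ≃⋆ₐ[ℂ] Op n) (Λ₂ (circuitOutput Λ₂ Y L C)))
        = twirlCoeff B * traceForm Λ₁ Λ₂ (circuitOutput Λ₁ X L C) (circuitOutput Λ₂ Y L C) := by
      intro C
      rw [← twirl_apply, twirl_eq hn, traceForm_apply]
      rw [h₁.trace_map, trace_circuitOutput h₁, hX]
    rw [Finset.expect_congr rfl fun C _ => h2 C, ← Finset.mul_expect, ih, pow_succ]
    ring

theorem sq_expect_norm_le {ι : Type*} [Fintype ι] [Nonempty ι] (f : ι → ℝ) :
    (𝔼 i, f i) ^ 2 ≤ 𝔼 i, f i ^ 2 := by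
  rw [Fintype.expect_eq_sum_div_card, Fintype.expect_eq_sum_div_card, div_pow]
  have hc : (0 : ℝ) < Fintype.card ι := by exact_mod_cast Fintype.card_pos
  have h := sq_sum_le_card_mul_sum_sq (s := Finset.univ) (f := f)
  rw [Finset.card_univ] at h
  rw [div_le_div_iff₀ (by positivity) hc]
  nlinarith

/-! ### Bounds on observables and states -/

theorem trace_mul_self_of_isHermitian {n : ℕ} {A : Op n} (hA : A.IsHermitian) :
    (A * A).trace.re = ∑ x, ∑ y, ‖A x y‖ ^ 2 := by
  rw [Matrix.trace, Complex.re_sum, Finset.sum_comm]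
  refine Finset.sum_congr rfl fun x _ => ?_
  rw [Matrix.diag_apply, Matrix.mul_apply, Complex.re_sum]
  refine Finset.sum_congr rfl fun y _ => ?_
  rw [← hA.apply x y, Complex.star_def, ← Complex.normSq_eq_conj_mul_self,
    Complex.ofReal_re, Complex.normSq_eq_norm_sq]

theorem trace_observable_le {n : ℕ} {O : Op n} (hO : O.IsHermitian)
    (hnorm : ‖Matrix.toEuclideanCLM (n := Bits n) (𝕜 := ℂ) O‖ ≤ 1) :
    (O * O).trace.re ≤ 2 ^ n := by
  rw [trace_mul_self_of_isHermitian hO, Finset.sum_comm]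
  -- Each column of `O` is the image of a basis vector, so its norm is at most the operator norm.
  have h : ∀ y : Bits n, ∑ x, ‖O x y‖ ^ 2 ≤ 1 := by
    intro y
    have h1 := (Matrix.toEuclideanCLM (n := Bits n) (𝕜 := ℂ) O).le_of_opNorm_le hnorm
      (EuclideanSpace.single y 1)
    rw [PiLp.norm_single, norm_one, mul_one] at h1
    have h2 : ‖Matrix.toEuclideanCLM (n := Bits n) (𝕜 := ℂ) O (EuclideanSpace.single y 1)‖ ^ 2
        = ∑ x, ‖O x y‖ ^ 2 := by
      rw [EuclideanSpace.norm_sq_eq]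
      refine Finset.sum_congr rfl fun x _ => ?_
      rw [Matrix.ofLp_toEuclideanCLM]
      simp
    rw [← h2]
    exact pow_le_one₀ (norm_nonneg _) h1
  calc _ ≤ ∑ _y : Bits n, (1 : ℝ) := Finset.sum_le_sum fun y _ => h y
    _ = 2 ^ n := by simp

theorem IsDensity.trace_mul_self_le {n : ℕ} {ρ : Op n} (hρ : IsDensity ρ) :
    (ρ * ρ).trace.re ≤ 1 := by
  have hH := hρ.1.isHermitian
  have h1 : (ρ * ρ).trace = ∑ i, ((hH.eigenvalues i ^ 2 : ℝ) : ℂ) := by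
    set D : Op n := Matrix.diagonal (RCLike.ofReal ∘ hH.eigenvalues) with hD
    have h : ρ = unitaryMap hH.eigenvectorUnitary D := hH.spectral_theorem
    conv_lhs => rw [h, ← unitaryMap_map_mul, trace_unitaryMap, hD, Matrix.diagonal_mul_diagonal,
      Matrix.trace_diagonal]
    simp [sq]
  have h2 : ∑ i, hH.eigenvalues i = 1 := by
    have := hH.trace_eq_sum_eigenvalues
    rw [hρ.2] at this
    rw [← RCLike.ofReal_sum, eq_comm] at this
    exact Complex.ofReal_eq_one.mp this
  rw [h1, ← Complex.ofReal_sum, Complex.ofReal_re, ← one_pow 2, ← h2]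
  exact Finset.sum_sq_le_sq_sum_of_nonneg fun i _ => hρ.1.eigenvalues_nonneg i

/-! ### The error of the rescaled noisy expectation value -/

theorem trace_circuitOutput_mul {n : ℕ} {Λ : Op n →ₗ[ℂ] Op n} (h : IsUnitalTP Λ) (ρ : Op n)
    {O : Op n} (hO : O.trace = 0) (L : ℕ) (C : Fin (L + 1) → cliffordLayers n) :
    (circuitOutput Λ ρ L C * O).trace = (circuitOutput Λ (tracelessPart ρ) L C * O).trace := by
  conv_lhs => rw [← tracelessPart_add ρ, circuitOutput_add_smul_one h, add_mul, Matrix.trace_add,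
    smul_mul_assoc, one_mul, Matrix.trace_smul, hO, smul_zero, add_zero]

theorem expect_trace_mul_trace {n : ℕ} (hn : 1 ≤ n) {Λ₁ Λ₂ : Op n →ₗ[ℂ] Op n}
    (h₁ : IsUnitalTP Λ₁) (h₂ : IsUnitalTP Λ₂) (U : UGroup n) {ρ : Op n} (hρ : ρ.trace = 1)
    {O : Op n} (hO : O.trace = 0) (L : ℕ) :
    𝔼 C : Fin (L + 1) → cliffordLayers n,
      (circuitOutput (Λ₁ ∘ₗ unitaryMap U) ρ L C * O).trace
        * (circuitOutput (Λ₂ ∘ₗ unitaryMap U) ρ L C * O).trace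
      = (O * O).trace / (4 ^ n - 1) * twirlCoeff (traceForm Λ₁ Λ₂) ^ L
        * (tracelessPart ρ * tracelessPart ρ).trace := by
  have hU := IsUnitalTP.unitaryMap U
  have h := expect_circuitOutput (Λ₂ := Λ₂ ∘ₗ unitaryMap U) (Y := tracelessPart ρ) hn
    (h₁.comp hU) (trace_tracelessPart hρ) L (observableForm O)
  have hc : twirlCoeff (traceForm (Λ₁ ∘ₗ unitaryMap U) (Λ₂ ∘ₗ unitaryMap U))
      = twirlCoeff (traceForm Λ₁ Λ₂) := twirlCoeff_comp_unitaryMap hn (traceForm Λ₁ Λ₂) U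
  rw [hc, twirlCoeff_observableForm hO] at h
  rw [← h]
  refine Finset.expect_congr rfl fun C _ => ?_
  rw [trace_circuitOutput_mul (h₁.comp hU) ρ hO, trace_circuitOutput_mul (h₂.comp hU) ρ hO,
    observableForm_apply]

theorem theoremS2 (n : ℕ) (hn : 1 ≤ n) (L : ℕ)
    (U : UGroup n)
    (N : Op n →ₗ[ℂ] Op n) (hN : IsChannel N) (hunital : N 1 = 1)
    (ρ₀ : Op n) (hρ₀ : IsDensity ρ₀)
    (O : Op n) (hO : O.IsHermitian) (htr : O.trace = 0)
    (hnorm : ‖Matrix.toEuclideanCLM (n := Bits n) (𝕜 := ℂ) O‖ ≤ 1)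
    (ψ : Bits n → ℂ) (hψ : star ψ ⬝ᵥ ψ = 1)
    (u s R : ℝ) (hu : u = unitarity ψ N) (hs : s = noiseStrength ψ N) (hu0 : u ≠ 0)
    (hR : R = (s / u) ^ L) :
    𝔼 C : Fin (L + 1) → cliffordLayers n,
        ‖(R : ℂ) * (noisyState U N ρ₀ L C * O).trace - (idealState U ρ₀ L C * O).trace‖
      ≤ √((2 ^ n - 1) / (2 ^ n + 1) * (1 - (s ^ 2 / u) ^ L)) := by
  have hNU := hN.isUnitalTP hunital
  have hU := IsUnitalTP.unitaryMap U
  have hid := IsUnitalTP.id (n := n)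
  have hρH := hρ₀.1.isHermitian
  have hu' : (u : ℂ) = twirlCoeff (traceForm N N) := by
    rw [← twirlCoeff_traceForm_eq hn hψ hNU hNU, hu, unitarity]
    simp only [sq]
  have hs' : (s : ℂ) = twirlCoeff (traceForm N LinearMap.id) := by
    rw [← twirlCoeff_traceForm_eq hn hψ hNU hid, hs, noiseStrength]
    simp only [LinearMap.id_apply, Matrix.trace_mul_comm (N _)]
  let a : (Fin (L + 1) → cliffordLayers n) → ℂ := fun C =>
    (circuitOutput (N ∘ₗ unitaryMap U) ρ₀ L C * O).trace
  -- The ideal circuit is treated as the noisy one with identity noise.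
  let b : (Fin (L + 1) → cliffordLayers n) → ℂ := fun C =>
    (circuitOutput (LinearMap.id ∘ₗ unitaryMap U) ρ₀ L C * O).trace
  have ha : ∀ C, (((a C).re : ℝ) : ℂ) = a C := fun C =>
    (isHermitian_circuitOutput (hNU.comp hU) hρH L C).trace_mul_re hO
  have hb : ∀ C, (((b C).re : ℝ) : ℂ) = b C := fun C =>
    (isHermitian_circuitOutput (hid.comp hU) hρH L C).trace_mul_re hO
  change 𝔼 C, ‖(R : ℂ) * a C - b C‖ ≤ _
  set T := (O * O).trace.re with hT
  set t := (tracelessPart ρ₀ * tracelessPart ρ₀).trace.re with ht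
  have htH : (tracelessPart ρ₀).IsHermitian := by
    refine Matrix.IsHermitian.sub hρH ?_
    rw [Matrix.IsHermitian, Matrix.conjTranspose_smul, Matrix.conjTranspose_one]
    simp
  have hT' : (T : ℂ) = (O * O).trace := hO.trace_mul_re hO
  have ht' : (t : ℂ) = (tracelessPart ρ₀ * tracelessPart ρ₀).trace := htH.trace_mul_re htH
  have hsq : 𝔼 C, ‖(R : ℂ) * a C - b C‖ ^ 2
      = T / (4 ^ n - 1) * t * (1 - (s ^ 2 / u) ^ L) := by
    apply Complex.ofReal_injective
    have h1 : ∀ C, ((‖(R : ℂ) * a C - b C‖ ^ 2 : ℝ) : ℂ)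
        = R ^ 2 * (a C * a C) - 2 * R * (a C * b C) + b C * b C := by
      intro C
      have h2 : (R : ℂ) * a C - b C = ((R * (a C).re - (b C).re : ℝ) : ℂ) := by
        rw [← ha, ← hb]; push_cast; simp
      rw [h2, Complex.norm_real, Real.norm_eq_abs, sq_abs]
      conv_rhs => rw [← ha, ← hb]
      push_cast
      ring
    rw [Complex.ofReal_expect]
    simp only [h1]
    rw [Finset.expect_add_distrib, Finset.expect_sub_distrib, ← Finset.mul_expect,
      ← Finset.mul_expect, expect_trace_mul_trace hn hNU hNU U hρ₀.2 htr,
      expect_trace_mul_trace hn hNU hid U hρ₀.2 htr, expect_trace_mul_trace hn hid hid U hρ₀.2 htr,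
      twirlCoeff_traceForm_id hn, ← hu', ← hs', ← hT', ← ht', hR]
    -- With this `R`, both `R² u^L` and `R s^L` equal `(s²/u)^L`.
    have hu0' : (u : ℂ) ≠ 0 := by exact_mod_cast hu0
    push_cast
    simp only [div_pow]
    field_simp
    ring
  have hnn : (0 : ℝ) ≤ 𝔼 C, ‖(R : ℂ) * a C - b C‖ :=
    Finset.expect_nonneg fun _ _ => norm_nonneg _
  have hle := sq_expect_norm_le fun C => ‖(R : ℂ) * a C - b C‖
  rw [hsq] at hle
  have hT0 : 0 ≤ T := by
    rw [hT, trace_mul_self_of_isHermitian hO]; positivity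
  have ht0 : 0 ≤ t := by
    rw [ht, trace_mul_self_of_isHermitian htH]; positivity
  have hT1 : T ≤ 2 ^ n := trace_observable_le hO hnorm
  have ht1 : t ≤ 1 - (2 ^ n)⁻¹ := by
    have h1 := hρ₀.trace_mul_self_le
    have h2 : t = (ρ₀ * ρ₀).trace.re - (2 ^ n)⁻¹ := by
      rw [ht, trace_tracelessPart_mul_self hρ₀.2, Complex.sub_re,
        show ((2 : ℂ) ^ n)⁻¹ = (((2 ^ n)⁻¹ : ℝ) : ℂ) by push_cast; rfl, Complex.ofReal_re]
    linarith
  have hd : (2 : ℝ) ≤ 2 ^ n := by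
    calc (2 : ℝ) = 2 ^ 1 := (pow_one _).symm
      _ ≤ 2 ^ n := pow_le_pow_right₀ (by norm_num) hn
  have h4 : (4 : ℝ) ^ n - 1 = (2 ^ n - 1) * (2 ^ n + 1) := by
    rw [show (4 : ℝ) = 2 ^ 2 by norm_num, ← pow_mul, mul_comm 2 n, pow_mul]; ring
  rw [h4] at hle
  generalize (2 : ℝ) ^ n = d at *
  rcases le_total 0 (1 - (s ^ 2 / u) ^ L) with hq | hq
  · refine Real.le_sqrt_of_sq_le (hle.trans (mul_le_mul_of_nonneg_right ?_ hq))
    have h5 : T * t ≤ d * (1 - d⁻¹) := mul_le_mul hT1 ht1 ht0 (by linarith)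
    have h6 : d * (1 - d⁻¹) = d - 1 := by
      rw [mul_sub, mul_inv_cancel₀ (by linarith)]; ring
    rw [div_mul_eq_mul_div, div_le_div_iff₀ (by nlinarith) (by linarith)]
    -- The estimates give the constant `1 / (d + 1)`; the stated one is larger by the factor `d - 1
    -- ≥ 1`.
    have h7 : 0 ≤ (d - 2) * ((d - 1) * (d + 1)) :=
      mul_nonneg (by linarith) (mul_nonneg (by linarith) (by linarith))
    nlinarith [mul_le_mul_of_nonneg_right (h5.trans h6.le) (by linarith : (0 : ℝ) ≤ d + 1)]
  -- If the radicand is not positive, `√` returns `0`, but then the second moment vanishes and so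
  -- does the mean error.
  · have h5 : T / ((d - 1) * (d + 1)) * t * (1 - (s ^ 2 / u) ^ L) ≤ 0 :=
      mul_nonpos_of_nonneg_of_nonpos (mul_nonneg (div_nonneg hT0 (by nlinarith)) ht0) hq
    have h6 := pow_eq_zero_iff two_ne_zero |>.mp (le_antisymm (hle.trans h5) (sq_nonneg _))
    rw [h6]
    exact Real.sqrt_nonneg _
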